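/- A \emph{degree sequence} of length $n\ge 1$ is a sequence $D=(d_1,\dots,d_n)$ of positive integers with $d_i\le n-1$ for all $i$ and with even sum $\Sigma=\sum_i d_i$; put $c_1=\max_i d_i$ and $c_2=\min_i d_i$. A \emph{realization} of a sequence $f=(f_1,\dots,f_n)$ of non-negative integers is a simple graph on $\{1,\dots,n\}$ in which vertex $i$ has degree $f_i$; $\mathcal G(f)$ is the set of realizations of $f$, and $D$ is \emph{graphic} if $\mathcal G(D)\neq\emptyset$. For a graphic $D$ let $$\partial^{++}(D)=\sum_{1\le i\le j\le n}\frac{|\mathcal G(D+e_i+e_j)|}{|\mathcal G(D)|},$$ where $e_i$ is the $i$-th unit vector. A \emph{region} is a set of degree sequences; it is \emph{simple} if membership is determined by $n,\Sigma,c_1,c_2$. A region is \emph{fully graphic} if all its elements are graphic, and it is \emph{P-stable} if there is a polynomial $p$ such that $\partial^{++}(D)\le p(n)$ for every graphic $D$ in the region, where $n$ is the length of $D$. \textbf{Theorem.} For $\varepsilon>0$ let $\mathbb D_\varepsilon$ be the simple region of all degree sequences with $$n\ge \frac1{2\varepsilon^2},\qquad 2\le c_2,\qquad 3\le c_1\le\sqrt{(1-\varepsilon)\Sigma}$$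 (which is empty if $\varepsilon\ge 1$). For every $\varepsilon>0$ the region $\mathbb D_\varepsilon$ is fully graphic and P-stable, and it is infinite if $\varepsilon<1$. Moreover, these regions extend the Greenhill--Sfragara region $\mathbb D_{GS}$ of all degree sequences with $2\le c_2$ and $3\le c_1\le\sqrt{\Sigma/9}$: one has $\mathbb D_{GS}=\mathbb D_{8/9}$, and for $0<\varepsilon<8/9$ the set of all $D\in\mathbb D_{GS}$ of length $n\ge\frac1{2\varepsilon^2}$ is a proper subset of $\mathbb D_\varepsilon$. -/

import Mathlib

/-- A degree sequence `(d₁, …, dₙ)`, `n ≥ 1`: positive integers, none exceeding `n - 1`, with even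
sum. -/
structure DegreeSequence where
  /-- the length `n` -/
  len : ℕ
  len_pos : 0 < len
  /-- the entries -/
  deg : Fin len → ℕ
  deg_pos : ∀ i, 0 < deg i
  deg_lt : ∀ i, deg i < len
  even_sum : Even (∑ i, deg i)

/-- The simple graphs on the vertex set `Fin n` in which vertex `i` has degree `f i`. -/
def realizations {n : ℕ} (f : Fin n → ℕ) : Set (SimpleGraph (Fin n)) :=
  {G | ∀ i, (G.neighborSet i).ncard = f i}

/-- The perturbation of `f` that adds `1` at position `i` and `1` at position `j`
(hence adds `2` at `j` when `i = j`). -/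
def perturb {n : ℕ} (f : Fin n → ℕ) (i j : Fin n) : Fin n → ℕ :=
  f + Pi.single i 1 + Pi.single j 1

namespace DegreeSequence

/-- The sum `Σ` of the degrees. -/
def total (D : DegreeSequence) : ℕ := ∑ i, D.deg i

/-- The largest degree `c₁`. -/
noncomputable def maxDeg (D : DegreeSequence) : ℕ := ⨆ i, D.deg i

/-- The smallest degree `c₂`. -/
noncomputable def minDeg (D : DegreeSequence) : ℕ := ⨅ i, D.deg i

/-- `D` is graphic: some simple graph has degree sequence `D`. -/
def Graphic (D : DegreeSequence) : Prop := (realizations D.deg).Nonempty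

/-- The quantity `∂⁺⁺(D)`: the sum over all perturbations at positions `i ≤ j` of the number of
realizations of the perturbed sequence, divided by the number of realizations of `D`. -/
noncomputable def boundary (D : DegreeSequence) : ℝ :=
  ∑ ij : Fin D.len × Fin D.len with ij.1 ≤ ij.2,
    ((realizations (perturb D.deg ij.1 ij.2)).ncard : ℝ) / ((realizations D.deg).ncard : ℝ)

end DegreeSequence

/-- The simple region of all degree sequences that satisfy a formula `φ` in
`n`, `Σ`, `c₁`, `c₂` (in this order). -/
def simpleRegion (φ : ℕ → ℕ → ℕ → ℕ → Prop) : Set DegreeSequence :=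
  {D | φ D.len D.total D.maxDeg D.minDeg}

/-- A region is fully graphic if each of its sequences is graphic. -/
def FullyGraphic (R : Set DegreeSequence) : Prop := ∀ D ∈ R, D.Graphic

/-- A region is P-stable if `∂⁺⁺` is bounded by a polynomial in the length on the graphic sequences
of the region. -/
def PStable (R : Set DegreeSequence) : Prop :=
  ∃ p : Polynomial ℝ, ∀ D ∈ R, D.Graphic → D.boundary ≤ p.eval (D.len : ℝ)

/-- The Greenhill–Sfragara region: `2 ≤ c₂` and `3 ≤ c₁ ≤ √(Σ / 9)`. -/
noncomputable def regionGS : Set DegreeSequence :=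
  simpleRegion fun _ S c₁ c₂ => 2 ≤ c₂ ∧ 3 ≤ c₁ ∧ (c₁ : ℝ) ≤ √((S : ℝ) / 9)

/-- The region `n ≥ 1 / (2ε²)`, `2 ≤ c₂` and `3 ≤ c₁ ≤ √((1 - ε) Σ)`. It is empty for `1 ≤ ε`. -/
noncomputable def regionGSPlus (ε : ℝ) : Set DegreeSequence :=
  simpleRegion fun n S c₁ c₂ =>
    1 / (2 * ε ^ 2) ≤ (n : ℝ) ∧ 2 ≤ c₂ ∧ 3 ≤ c₁ ∧ (c₁ : ℝ) ≤ √((1 - ε) * (S : ℝ))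

/-!
Fix a realization `G` of `D + eᵢ + eⱼ` and a few neighbours of `i` and `j`, and grow this set in
layers: each layer adds the vertices whose surplus a single edge exchange moves into the previous
layer. If a layer is not a clique, or if two of the outer vertices it is grown through are adjacent,
changing an edge there and pushing the resulting surplus back through the layers to `i` and `j`
turns `G` into a realization of `D`, at a cost of boundedly many edges per layer. Otherwise every
layer is a clique, so it has at most `c₁ + 3` vertices; but counting the edges between a layer and
the outer vertices shows that `c₁² ≤ (1 - ε) Σ` forces each layer to grow by an amount proportional
to `c₁`, and the process stops after a number of layers depending on `ε` only. Hence each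
realization of `D + eᵢ + eⱼ` is within a bounded number of edges of one of `D`, and counting the
possible changes bounds the ratios `|𝒢(D + eᵢ + eⱼ)| / |𝒢(D)|` polynomially.

That `D` is graphic follows from `c₁ (c₁ + 1) ≤ Σ`, a consequence of `n ≥ 1 / (2ε²)`, by balancing
the degrees of a graph whose edge set is an initial segment in the colexicographic order.
-/

open Finset
open scoped symmDiff

section EdgeMoves

variable {V : Type*} {G H K : SimpleGraph V} {x y a b u : V} {k m : ℕ}

/-- `G` with the edge `xy` added. -/
def addEdge (G : SimpleGraph V) (x y : V) : SimpleGraph V := G ⊔ SimpleGraph.edge x y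

/-- `G` with the edge `xy` removed. -/
def delEdge (G : SimpleGraph V) (x y : V) : SimpleGraph V := G \ SimpleGraph.edge x y

/-- `G` with the edge `au` replaced by the edge `ux`; this moves one unit of degree from `a`
to `x`. -/
def hinge (G : SimpleGraph V) (a u x : V) : SimpleGraph V := addEdge (delEdge G a u) u x

theorem addEdge_adj (h : x ≠ y) :
    (addEdge G x y).Adj a b ↔ G.Adj a b ∨ (a = x ∧ b = y) ∨ (a = y ∧ b = x) := by
  rw [addEdge, SimpleGraph.sup_adj, SimpleGraph.edge_adj]
  grind

theorem delEdge_adj :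
    (delEdge G x y).Adj a b ↔ G.Adj a b ∧ ¬ ((a = x ∧ b = y) ∨ (a = y ∧ b = x)) := by
  rw [delEdge, SimpleGraph.sdiff_adj, SimpleGraph.edge_adj]
  grind [SimpleGraph.Adj.ne]

theorem hinge_adj (h : u ≠ x) :
    (hinge G a u x).Adj b y ↔ (G.Adj b y ∧ ¬ ((b = a ∧ y = u) ∨ (b = u ∧ y = a))) ∨
      (b = u ∧ y = x) ∨ (b = x ∧ y = u) := by
  rw [hinge, addEdge_adj h, delEdge_adj]

theorem addEdge_delEdge (h : G.Adj x y) : addEdge (delEdge G x y) x y = G := by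
  rw [addEdge, delEdge, sdiff_sup_cancel ((SimpleGraph.edge_le_iff G).2 (Or.inr h))]

/-- `G` and `H` differ in at most `m` edges. The bound is meaningful for finite `V` only, since
`Set.ncard` vanishes on infinite sets. -/
def Close (m : ℕ) (G H : SimpleGraph V) : Prop := (G ∆ H).edgeSet.ncard ≤ m

theorem Close.refl (G : SimpleGraph V) : Close 0 G G := by simp [Close]

theorem Close.mono (h : m ≤ k) (hc : Close m G H) : Close k G H := le_trans hc h

theorem Close.trans [Finite V] (h₁ : Close m G H) (h₂ : Close k H K) : Close (m + k) G K :=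
  calc (G ∆ K).edgeSet.ncard
      ≤ ((G ∆ H).edgeSet ∪ (H ∆ K).edgeSet).ncard := by
        rw [← SimpleGraph.edgeSet_sup]
        exact Set.ncard_le_ncard (SimpleGraph.edgeSet_mono (symmDiff_triangle G H K))
    _ ≤ m + k := (Set.ncard_union_le _ _).trans (add_le_add h₁ h₂)

theorem close_of_symmDiff_le_edge (h : G ∆ H ≤ SimpleGraph.edge x y) : Close 1 G H :=
  (Set.ncard_le_ncard ((SimpleGraph.edgeSet_mono h).trans SimpleGraph.edgeSet_edge_subset)
    (Set.finite_singleton _)).trans (Set.ncard_singleton _).le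

theorem close_addEdge (G : SimpleGraph V) (x y : V) : Close 1 G (addEdge G x y) :=
  close_of_symmDiff_le_edge (by
    rw [addEdge, symmDiff_of_le le_sup_left, sup_sdiff_left_self]
    exact sdiff_le)

theorem close_delEdge (G : SimpleGraph V) (x y : V) : Close 1 G (delEdge G x y) :=
  close_of_symmDiff_le_edge (by
    rw [delEdge, symmDiff_of_ge sdiff_le]
    exact sdiff_sdiff_le)

theorem close_hinge [Finite V] (G : SimpleGraph V) (a u x : V) : Close 2 G (hinge G a u x) :=
  (close_delEdge G a u).trans (close_addEdge _ u x)

end EdgeMoves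

section Degrees

variable {V : Type*} [Fintype V] {G H : SimpleGraph V} {x y a u : V} {d : V → ℕ} {k m : ℕ}

open Classical in
/-- The neighbourhood of `x` as a finset, without decidability assumptions on `G`. -/
noncomputable def nbhd (G : SimpleGraph V) (x : V) : Finset V := univ.filter (G.Adj x)

/-- The vector of vertex degrees. -/
noncomputable def degs (G : SimpleGraph V) (x : V) : ℕ := #(nbhd G x)

@[simp]
theorem mem_nbhd : y ∈ nbhd G x ↔ G.Adj x y := by simp [nbhd]

theorem mem_realizations {n : ℕ} {G : SimpleGraph (Fin n)} {f : Fin n → ℕ} :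
    G ∈ realizations f ↔ degs G = f := by
  have ncard_eq (x : Fin n) : (G.neighborSet x).ncard = degs G x := by
    rw [degs, ← Set.ncard_coe_finset]
    congr 1
    ext y
    simp
  simp only [realizations, Set.mem_ofPred_eq, ncard_eq, funext_iff]

theorem degs_addEdge [DecidableEq V] (hxy : x ≠ y) (h : ¬ G.Adj x y) :
    degs (addEdge G x y) = degs G + Pi.single x 1 + Pi.single y 1 := by
  funext a
  have nbhd_eq : nbhd (addEdge G x y) a =
      if a = x then insert y (nbhd G a) else if a = y then insert x (nbhd G a) else nbhd G a := by
    ext b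
    split_ifs <;> simp only [mem_nbhd, mem_insert, addEdge_adj hxy] <;> grind
  have h' : ¬ G.Adj y x := fun e => h e.symm
  rw [degs, nbhd_eq]
  split_ifs with hx hy
  · subst hx
    simp [degs, h, hxy]
  · subst hy
    simp [degs, h', hx]
  · simp [degs, hx, hy]

theorem degs_delEdge [DecidableEq V] (h : G.Adj x y) :
    degs (delEdge G x y) + Pi.single x 1 + Pi.single y 1 = degs G := by
  rw [← degs_addEdge h.ne (by simp [delEdge_adj]), addEdge_delEdge h]

theorem degs_hinge [DecidableEq V] (hau : G.Adj a u) (hux : u ≠ x) (h : ¬ G.Adj u x) :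
    degs (hinge G a u x) + Pi.single a 1 = degs G + Pi.single x 1 := by
  rw [hinge, degs_addEdge hux (by simp [delEdge_adj, h]), ← degs_delEdge hau]
  abel

/-- Some graph with degree vector `d` differs from `G` in at most `m` edges. -/
def HasRealizationWithin (d : V → ℕ) (m : ℕ) (G : SimpleGraph V) : Prop :=
  ∃ H, degs H = d ∧ Close m G H

theorem HasRealizationWithin.mono (h : m ≤ k) :
    HasRealizationWithin d m G → HasRealizationWithin d k G
  | ⟨H, hH, hc⟩ => ⟨H, hH, hc.mono h⟩

theorem HasRealizationWithin.of_close (hc : Close k G H) :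
    HasRealizationWithin d m H → HasRealizationWithin d (k + m) G
  | ⟨K, hK, hc'⟩ => ⟨K, hK, hc.trans hc'⟩

end Degrees

section Layers

variable {V : Type*} [Fintype V] [DecidableEq V] {G H : SimpleGraph V} {S A B B' : Finset V}
  {i j x b c c' : V} {d : V → ℕ} {k : ℕ}

/-- The elements of `B` other than `x` that are not adjacent to `x`. -/
noncomputable def nonNbrs (G : SimpleGraph V) (B : Finset V) (x : V) : Finset V :=
  B \ insert x (nbhd G x)

/-- The vertices outside `S` with at least two non-neighbours in `B`. Through such a vertex the
surplus of a neighbour can be moved into `B`; two non-neighbours are asked for because one vertex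
of `B` may already carry the other surplus. -/
noncomputable def outer (G : SimpleGraph V) (S B : Finset V) : Finset V :=
  univ.filter fun x => x ∉ S ∧ 2 ≤ #(nonNbrs G B x)

/-- `B` together with the neighbours outside `S` of `outer G S B`, from which a surplus can be moved
into `B` by a single hinge. -/
noncomputable def expand (G : SimpleGraph V) (S B : Finset V) : Finset V :=
  B ∪ (outer G S B).biUnion (nbhd G) \ S

/-- The set obtained from `B` by applying `expand` `k` times. -/
noncomputable def layer (G : SimpleGraph V) (S B : Finset V) (k : ℕ) : Finset V :=
  (expand G S)^[k] B

theorem mem_nonNbrs : b ∈ nonNbrs G B x ↔ b ∈ B ∧ b ≠ x ∧ ¬ G.Adj x b := by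
  simp [nonNbrs]

theorem mem_outer : x ∈ outer G S B ↔ x ∉ S ∧ 2 ≤ #(nonNbrs G B x) := by
  simp [outer]

theorem mem_expand : x ∈ expand G S B ↔ x ∈ B ∨ (∃ a ∈ outer G S B, G.Adj a x) ∧ x ∉ S := by
  simp [expand]

theorem outer_mono (h : B ⊆ B') : outer G S B ⊆ outer G S B' := fun _ hx =>
  mem_outer.2 ((mem_outer.1 hx).imp_right fun h₂ =>
    h₂.trans (card_le_card (sdiff_subset_sdiff h Subset.rfl)))

theorem layer_succ (G : SimpleGraph V) (S B : Finset V) (k : ℕ) :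
    layer G S B (k + 1) = expand G S (layer G S B k) :=
  Function.iterate_succ_apply' _ _ _

theorem layer_mono (G : SimpleGraph V) (S B : Finset V) : Monotone (layer G S B) :=
  monotone_nat_of_le_succ fun k => by
    rw [layer_succ]
    exact subset_union_left

theorem disjoint_layer (h : Disjoint S B) (k : ℕ) : Disjoint S (layer G S B k) := by
  induction k with
  | zero => exact h
  | succ k ih =>
    rw [layer_succ]
    exact disjoint_union_right.2 ⟨ih, disjoint_sdiff⟩

/-- Any two distinct vertices of `B` can be matched along edges of `G` to `i` and `j`. -/
def Pairable (G : SimpleGraph V) (i j : V) (B : Finset V) : Prop :=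
  Disjoint {i, j} B ∧
    ∀ c ∈ B, ∀ c' ∈ B, c ≠ c' → (G.Adj i c ∧ G.Adj j c') ∨ (G.Adj i c' ∧ G.Adj j c)

/-- `H` has the degrees of `G` except for a surplus of one at both `c` and `c'`. It agrees with `G`
at the vertices of `S`, and up to pairs at `c` and `c'` also between `A` and `B`. -/
structure Surplus (G : SimpleGraph V) (S A B : Finset V) (H : SimpleGraph V) (c c' : V) :
    Prop where
  ne : c ≠ c'
  disjoint : Disjoint A (insert c (insert c' B))
  keeps : ∀ a ∈ A, ∀ y ∈ insert c (insert c' B), G.Adj a y → H.Adj a y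
  gains : ∀ a ∈ A, ∀ y ∈ B, H.Adj a y → G.Adj a y ∨ y = c ∨ y = c'
  special : ∀ s ∈ S, ∀ y, H.Adj s y ↔ G.Adj s y
  degs_eq : degs H = degs G + Pi.single c 1 + Pi.single c' 1

namespace Surplus

theorem symm (h : Surplus G S A B H c c') : Surplus G S A B H c' c where
  ne := h.ne.symm
  disjoint := by rw [insert_comm]; exact h.disjoint
  keeps := by rw [insert_comm]; exact h.keeps
  gains a ha y hy hay := (h.gains a ha y hy hay).imp_right Or.symm
  special := h.special
  degs_eq := by rw [h.degs_eq, add_right_comm]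

theorem mono (h : Surplus G S A B H c c') (hB : B' ⊆ B) : Surplus G S A B' H c c' where
  ne := h.ne
  disjoint := h.disjoint.mono_right (insert_subset_insert _ (insert_subset_insert _ hB))
  keeps a ha y hy := h.keeps a ha y (insert_subset_insert _ (insert_subset_insert _ hB) hy)
  gains a ha y hy := h.gains a ha y (hB hy)
  special := h.special
  degs_eq := h.degs_eq

theorem step (h : Surplus G S A B H c c') (hBS : Disjoint S B) (hA : outer G S B ⊆ A)
    (hc : c ∈ expand G S B) :
    ∃ H' c₂, Surplus G S A B H' c₂ c' ∧ c₂ ∈ B ∧ Close 2 H H' := by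
  by_cases hcB : c ∈ B
  · exact ⟨H, c, h, hcB, (Close.refl H).mono zero_le_two⟩
  obtain ⟨⟨a, ha, hac⟩, hcS⟩ := (mem_expand.1 hc).resolve_left hcB
  have haA := hA ha
  obtain ⟨haS, two_le⟩ := mem_outer.1 ha
  obtain ⟨c₂, hc₂, hne⟩ := exists_mem_ne two_le c'
  obtain ⟨hc₂B, hc₂a, hac₂⟩ := mem_nonNbrs.1 hc₂
  have hHac : H.Adj a c := h.keeps a haA c (mem_insert_self _ _) hac
  have hHac₂ : ¬ H.Adj a c₂ := fun hH => by
    rcases h.gains a haA c₂ hc₂B hH with hG | rfl | rfl <;> contradiction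
  have hAne : ∀ x ∈ A, x ≠ c ∧ x ≠ c' ∧ x ∉ B := fun x hx => by
    simpa using disjoint_left.1 h.disjoint hx
  have hSB : ∀ s ∈ S, s ∉ B := fun s hs => disjoint_left.1 hBS hs
  have hcc' := h.ne
  refine ⟨hinge H c a c₂, c₂, ⟨hne, ?_, ?_, ?_, ?_, ?_⟩, hc₂B, close_hinge H c a c₂⟩
  · exact h.disjoint.mono_right (by grind)
  · have hkeeps := h.keeps
    simp only [hinge_adj hc₂a.symm]
    grind
  · have hgains := h.gains
    simp only [hinge_adj hc₂a.symm]
    grind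
  · have hspecial := h.special
    simp only [hinge_adj hc₂a.symm]
    grind
  · have e := degs_hinge hHac.symm hc₂a.symm hHac₂
    refine add_right_cancel (b := Pi.single c 1) (e.trans ?_)
    rw [h.degs_eq]
    abel

theorem hasRealizationWithin_of_adj (h : Surplus G {i, j} A B H c c')
    (hd : degs G = d + Pi.single i 1 + Pi.single j 1) (hij : Disjoint {i, j} B) (hc : c ∈ B)
    (hic : G.Adj i c) (hjc' : G.Adj j c') :
    HasRealizationWithin d 2 H := by
  have hHic : H.Adj i c := (h.special i (by simp) c).2 hic
  have hHjc' : (delEdge H i c).Adj j c' := by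
    have hjc : j ≠ c := fun e => disjoint_left.1 hij (by simp [e]) hc
    have hne := h.ne
    rw [delEdge_adj, h.special j (by simp) c']
    grind
  refine ⟨delEdge (delEdge H i c) j c', ?_, (close_delEdge _ _ _).trans (close_delEdge _ _ _)⟩
  have e := degs_delEdge hHic
  rw [← degs_delEdge hHjc', h.degs_eq, hd] at e
  funext t
  have := congrFun e t
  simp only [Pi.add_apply] at this
  omega

theorem resolve (hd : degs G = d + Pi.single i 1 + Pi.single j 1) (hP : Pairable G i j B)
    (h : Surplus G {i, j} A (layer G {i, j} B k) H c c') (hc : c ∈ layer G {i, j} B k)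
    (hc' : c' ∈ layer G {i, j} B k) (hA : ∀ l < k, outer G {i, j} (layer G {i, j} B l) ⊆ A) :
    HasRealizationWithin d (4 * k + 2) H := by
  induction k generalizing H c c' with
  | zero =>
    rcases hP.2 c hc c' hc' h.ne with ⟨hic, hjc'⟩ | ⟨hic', hjc⟩
    · exact h.hasRealizationWithin_of_adj hd hP.1 hc hic hjc'
    · exact h.symm.hasRealizationWithin_of_adj hd hP.1 hc' hic' hjc
  | succ k ih =>
    have hdisj := disjoint_layer (G := G) hP.1 k
    have hAk := hA k k.lt_succ_self
    have hsub := layer_mono G {i, j} B k.le_succ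
    rw [layer_succ] at hc hc'
    obtain ⟨H₁, c₁, h₁, hc₁, hcl₁⟩ := (h.mono hsub).step hdisj hAk hc
    obtain ⟨H₂, c₂, h₂, hc₂, hcl₂⟩ := h₁.symm.step hdisj hAk hc'
    exact ((ih h₂ hc₂ hc₁ fun l hl => hA l (hl.trans k.lt_succ_self)).of_close
      (hcl₁.trans hcl₂)).mono (by omega)

theorem of_not_adj {b b' : V} (hne : b ≠ b') (hn : ¬ G.Adj b b') (hb : b ∈ B) (hb' : b' ∈ B)
    (hAB : Disjoint A B) (hSB : Disjoint S B) : Surplus G S A B (addEdge G b b') b b' where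
  ne := hne
  disjoint := by rwa [insert_eq_of_mem hb', insert_eq_of_mem hb]
  keeps a _ y _ h := (addEdge_adj hne).2 (Or.inl h)
  gains a _ y _ h := by
    rw [addEdge_adj hne] at h
    grind
  special s hs y := by
    have := disjoint_left.1 hSB hs
    rw [addEdge_adj hne]
    grind
  degs_eq := degs_addEdge hne hn

theorem exists_of_adj {a a' : V} (ha : a ∈ outer G S B) (ha' : a' ∈ outer G S B)
    (haa' : G.Adj a a') (hAB : Disjoint (outer G S B) B) (hSB : Disjoint S B) :
    ∃ H c c', Surplus G S (outer G S B) B H c c' ∧ c ∈ B ∧ c' ∈ B ∧ Close 3 G H := by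
  obtain ⟨haS, two_le⟩ := mem_outer.1 ha
  obtain ⟨ha'S, two_le'⟩ := mem_outer.1 ha'
  obtain ⟨c, hc⟩ := card_pos.1 (zero_lt_two.trans_le two_le)
  obtain ⟨c', hc', hne⟩ := exists_mem_ne two_le' c
  obtain ⟨hcB, hca, hac⟩ := mem_nonNbrs.1 hc
  obtain ⟨hc'B, hc'a', ha'c'⟩ := mem_nonNbrs.1 hc'
  have hAB' : ∀ x ∈ outer G S B, x ∉ B := fun x hx => disjoint_left.1 hAB hx
  have hSB' : ∀ s ∈ S, s ∉ B := fun s hs => disjoint_left.1 hSB hs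
  have ha'c : a' ≠ c := fun e => hAB' a' ha' (e ▸ hcB)
  have adj_iff (x y : V) : (addEdge (hinge G a' a c) a' c').Adj x y ↔
      ((G.Adj x y ∧ ¬ ((x = a' ∧ y = a) ∨ (x = a ∧ y = a'))) ∨ (x = a ∧ y = c) ∨
        (x = c ∧ y = a)) ∨ (x = a' ∧ y = c') ∨ (x = c' ∧ y = a') := by
    rw [addEdge_adj hc'a'.symm, hinge_adj hca.symm]
  refine ⟨addEdge (hinge G a' a c) a' c', c, c', ⟨hne.symm, ?_, ?_, ?_, ?_, ?_⟩, hcB, hc'B,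
    (close_hinge G a' a c).trans (close_addEdge _ a' c')⟩
  · rwa [insert_eq_of_mem hc'B, insert_eq_of_mem hcB]
  · grind
  · grind
  · grind
  · have hn : ¬ (hinge G a' a c).Adj a' c' := by
      rw [hinge_adj hca.symm]
      grind
    rw [degs_addEdge hc'a'.symm hn, degs_hinge haa'.symm hca.symm hac]

end Surplus

theorem hasRealizationWithin_of_not_isClique_layer (hd : degs G = d + Pi.single i 1 + Pi.single j 1)
    (hP : Pairable G i j B) (hcl : ¬ G.IsClique (layer G {i, j} B k : Set V))
    (hA : ∀ l < k, outer G {i, j} (layer G {i, j} B l) ⊆ A)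
    (hAB : Disjoint A (layer G {i, j} B k)) : HasRealizationWithin d (4 * k + 3) G := by
  simp only [SimpleGraph.isClique_iff, Set.Pairwise, not_forall, mem_coe] at hcl
  obtain ⟨b, hb, b', hb', hne, hn⟩ := hcl
  exact ((Surplus.of_not_adj hne hn hb hb' hAB (disjoint_layer hP.1 k)).resolve hd hP hb hb'
    hA |>.of_close (close_addEdge G b b')).mono (by omega)

theorem hasRealizationWithin_of_not_isIndepSet_outer
    (hd : degs G = d + Pi.single i 1 + Pi.single j 1) (hP : Pairable G i j B)
    (hout : ¬ G.IsIndepSet (outer G {i, j} (layer G {i, j} B k) : Set V))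
    (hAB : Disjoint (outer G {i, j} (layer G {i, j} B k)) (layer G {i, j} B k)) :
    HasRealizationWithin d (4 * k + 5) G := by
  simp only [SimpleGraph.isIndepSet_iff, Set.Pairwise, not_forall, mem_coe, not_not] at hout
  obtain ⟨a, ha, a', ha', -, hadj⟩ := hout
  obtain ⟨H, c, c', h, hc, hc', hcl⟩ :=
    Surplus.exists_of_adj ha ha' hadj hAB (disjoint_layer hP.1 k)
  exact ((h.resolve hd hP hc hc' fun l hl => outer_mono (layer_mono _ _ _ hl.le)).of_close
    hcl).mono (by omega)

theorem disjoint_outer_of_isClique (h : G.IsClique (B : Set V)) : Disjoint (outer G S B) B :=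
  disjoint_left.2 fun x hx hxB => by
    obtain ⟨c, hc⟩ := card_pos.1 (zero_lt_two.trans_le (mem_outer.1 hx).2)
    obtain ⟨hcB, hcx, hxc⟩ := mem_nonNbrs.1 hc
    exact hxc (h hxB hcB hcx.symm)

theorem disjoint_outer_expand (h : G.IsClique (B : Set V))
    (h' : G.IsIndepSet (outer G S B : Set V)) : Disjoint (outer G S B) (expand G S B) :=
  disjoint_left.2 fun x hx hx' => by
    rcases mem_expand.1 hx' with hxB | ⟨⟨a, ha, hax⟩, -⟩
    · exact disjoint_left.1 (disjoint_outer_of_isClique h) hx hxB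
    · exact h' ha hx hax.ne hax

theorem isClique_layer_and_isIndepSet_outer {N : ℕ}
    (hd : degs G = d + Pi.single i 1 + Pi.single j 1) (hP : Pairable G i j B)
    (hN : ¬ HasRealizationWithin d (4 * N + 5) G) (hk : k ≤ N) :
    G.IsClique (layer G {i, j} B k : Set V) ∧
      G.IsIndepSet (outer G {i, j} (layer G {i, j} B k) : Set V) := by
  suffices hcl : G.IsClique (layer G {i, j} B k : Set V) by
    refine ⟨hcl, by_contra fun hout => hN ?_⟩
    exact (hasRealizationWithin_of_not_isIndepSet_outer hd hP hout
      (disjoint_outer_of_isClique hcl)).mono (by omega)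
  induction k with
  | zero =>
    refine by_contra fun hcl => hN ?_
    exact (hasRealizationWithin_of_not_isClique_layer (A := ∅) hd hP hcl
      (fun l hl => absurd hl l.not_lt_zero) (disjoint_empty_left _)).mono (by omega)
  | succ k ih =>
    have hclk := ih (by omega)
    refine by_contra fun hcl => hN ?_
    by_cases hout : G.IsIndepSet (outer G {i, j} (layer G {i, j} B k) : Set V)
    · have hdisj : Disjoint (outer G {i, j} (layer G {i, j} B k)) (layer G {i, j} B (k + 1)) := by
        rw [layer_succ]
        exact disjoint_outer_expand hclk hout
      exact (hasRealizationWithin_of_not_isClique_layer hd hP hcl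
        (fun l hl => outer_mono (layer_mono _ _ _ (Nat.lt_succ_iff.1 hl))) hdisj).mono (by omega)
    · exact (hasRealizationWithin_of_not_isIndepSet_outer hd hP hout
        (disjoint_outer_of_isClique hclk)).mono (by omega)

end Layers

section Growth

variable {V : Type*} [Fintype V] [DecidableEq V] {G : SimpleGraph V} {S B : Finset V} {M : ℕ}

theorem sum_card_nbhd_inter_comm (G : SimpleGraph V) (X Y : Finset V) :
    ∑ x ∈ X, #(nbhd G x ∩ Y) = ∑ y ∈ Y, #(nbhd G y ∩ X) := by
  classical
  have above (x : V) : nbhd G x ∩ Y = bipartiteAbove G.Adj Y x := by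
    ext; simp [and_comm]
  have below (y : V) : nbhd G y ∩ X = bipartiteBelow G.Adj X y := by
    ext; simp [and_comm, G.adj_comm]
  simp only [above, below]
  exact sum_card_bipartiteAbove_eq_sum_card_bipartiteBelow _

omit [DecidableEq V] in
theorem card_le_of_isClique (hM : ∀ x, degs G x ≤ M) (h : G.IsClique (B : Set V)) :
    #B ≤ M + 1 := by
  classical
  rcases B.eq_empty_or_nonempty with rfl | ⟨b, hb⟩
  · simp
  have hsub : B.erase b ⊆ nbhd G b := fun x hx =>
    mem_nbhd.2 (h hb (mem_of_mem_erase hx) (ne_of_mem_erase hx).symm)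
  have : #B - 1 ≤ M := pred_card_le_card_erase.trans ((card_le_card hsub).trans (hM b))
  omega

omit [DecidableEq V] in
theorem sum_degs_le (hM : ∀ x, degs G x ≤ M) (X : Finset V) : ∑ x ∈ X, degs G x ≤ #X * M :=
  sum_le_card_nsmul _ _ _ fun x _ => hM x

theorem sum_card_nbhd_inter_le (hM : ∀ x, degs G x ≤ M) (X Y : Finset V) :
    ∑ x ∈ X, #(nbhd G x ∩ Y) ≤ #X * M :=
  sum_le_card_nsmul _ _ _ fun x _ => (card_le_card inter_subset_left).trans (hM x)

theorem sum_degs_outer (G : SimpleGraph V) (S B : Finset V) :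
    ∑ x ∈ outer G S B, degs G x = ∑ y ∈ S ∪ expand G S B, #(nbhd G y ∩ outer G S B) := by
  rw [← sum_card_nbhd_inter_comm]
  refine sum_congr rfl fun x hx => ?_
  have hsub : nbhd G x ⊆ S ∪ expand G S B := fun y hy => by
    by_cases hyS : y ∈ S
    · exact mem_union_left _ hyS
    · exact mem_union_right _ (mem_expand.2 (Or.inr ⟨⟨x, hx, mem_nbhd.1 hy⟩, hyS⟩))
  rw [inter_eq_left.2 hsub, degs]

theorem sum_degs_outer_le (hM : ∀ x, degs G x ≤ M) (hS : #S ≤ 2) :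
    ∑ x ∈ outer G S B, degs G x ≤ (#(expand G S B) + 2) * M := by
  rw [sum_degs_outer]
  refine (sum_card_nbhd_inter_le hM _ _).trans (Nat.mul_le_mul_right _ ?_)
  exact (card_union_le _ _).trans (by omega)

theorem sum_degs_outer_le_add (hM : ∀ x, degs G x ≤ M) (hS : #S ≤ 2) :
    ∑ x ∈ outer G S B, degs G x ≤
      2 * M + ∑ y ∈ B, #(nbhd G y ∩ outer G S B) + #(expand G S B \ B) * M := by
  have hBE : B ⊆ expand G S B := subset_union_left
  have hsplit := sum_sdiff (f := fun y => #(nbhd G y ∩ outer G S B)) hBE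
  have hunion := sum_union_inter (s₁ := S) (s₂ := expand G S B)
    (f := fun y => #(nbhd G y ∩ outer G S B))
  have hleft := sum_card_nbhd_inter_le hM S (outer G S B)
  have hright := sum_card_nbhd_inter_le hM (expand G S B \ B) (outer G S B)
  have hSM : #S * M ≤ 2 * M := Nat.mul_le_mul_right _ hS
  rw [sum_degs_outer]
  omega

theorem card_compl_outer_mul_le (G : SimpleGraph V) (S B : Finset V) :
    #(S ∪ outer G S B)ᶜ * (#B - 2) ≤ ∑ y ∈ B, #(nbhd G y ∩ (S ∪ outer G S B)ᶜ) := by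
  rw [sum_card_nbhd_inter_comm]
  refine card_nsmul_le_sum _ _ _ fun x hx => ?_
  have hone : #(nonNbrs G B x) ≤ 1 := by
    simp only [mem_compl, mem_union, mem_outer, not_or, not_and, not_le] at hx
    exact Nat.lt_succ_iff.1 (hx.2 hx.1)
  have hsub : B ⊆ insert x (nonNbrs G B x ∪ nbhd G x ∩ B) := fun y hy => by
    simp only [mem_insert, mem_union, mem_inter, mem_nbhd, mem_nonNbrs]
    tauto
  have := (card_le_card hsub).trans
    ((card_insert_le _ _).trans (Nat.succ_le_succ (card_union_le _ _)))
  omega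

theorem mul_sum_le_of_double_count {T γ P Q Δ b : ℕ} (hT : T ≤ 4 * M + γ * M + P + Δ * M)
    (hQ : γ * b ≤ Q) (hPQ : P + Q ≤ (b + 2) * M) (hb : b ≤ M) :
    b * T ≤ b * (4 * M + Δ * M + M ^ 2) + 2 * M ^ 2 :=
  calc b * T ≤ b * (4 * M + γ * M + P + Δ * M) := Nat.mul_le_mul_left _ hT
    _ = b * (4 * M + Δ * M) + (b * P + γ * b * M) := by ring
    _ ≤ b * (4 * M + Δ * M) + (M * P + Q * M) := by gcongr
    _ = b * (4 * M + Δ * M) + (P + Q) * M := by ring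
    _ ≤ b * (4 * M + Δ * M) + (b + 2) * M * M := by gcongr
    _ = b * (4 * M + Δ * M + M ^ 2) + 2 * M ^ 2 := by ring

-- The degrees in `outer G S B` are bounded by counting its edges from their other ends, which all
-- lie in `S ∪ expand G S B`; the remaining vertices outside `S` are few since each of them sends at
-- least `#B - 2` edges to `B`.
theorem card_mul_sum_degs_le (hM : ∀ x, degs G x ≤ M) (hS : #S ≤ 2) (hcl : G.IsClique (B : Set V))
    (hB : 2 ≤ #B) :
    (#B - 2) * ∑ x, degs G x ≤
      (#B - 2) * (4 * M + #(expand G S B \ B) * M + M ^ 2) + 2 * M ^ 2 := by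
  let A := outer G S B
  let C := (S ∪ A)ᶜ
  have htotal : ∑ x, degs G x ≤
      4 * M + #C * M + ∑ y ∈ B, #(nbhd G y ∩ A) + #(expand G S B \ B) * M := by
    have hsplit : ∑ x ∈ S ∪ A, degs G x + ∑ x ∈ C, degs G x = ∑ x, degs G x :=
      sum_add_sum_compl _ _
    have hunion := sum_union_inter (s₁ := S) (s₂ := A) (f := degs G)
    have hSM : #S * M ≤ 2 * M := Nat.mul_le_mul_right _ hS
    have hdegS := sum_degs_le hM S
    have hdegC := sum_degs_le hM C
    have hdegA : ∑ x ∈ A, degs G x ≤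
        2 * M + ∑ y ∈ B, #(nbhd G y ∩ A) + #(expand G S B \ B) * M := sum_degs_outer_le_add hM hS
    omega
  have hedges : ∑ y ∈ B, #(nbhd G y ∩ A) + ∑ y ∈ B, #(nbhd G y ∩ C) ≤ (#B - 2 + 2) * M := by
    rw [← sum_add_distrib, Nat.sub_add_cancel hB]
    refine sum_le_card_nsmul _ _ _ fun y _ => ?_
    have hAC : Disjoint A C := disjoint_compl_right.mono_left subset_union_right
    rw [← card_union_of_disjoint (hAC.mono inter_subset_right inter_subset_right)]
    exact (card_le_card (union_subset inter_subset_left inter_subset_left)).trans (hM y)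
  have hBM := card_le_of_isClique hM hcl
  exact mul_sum_le_of_double_count htotal (card_compl_outer_mul_le G S B) hedges (by omega)

theorem lt_card_expand_sdiff {b δ : ℕ} (hM : ∀ x, degs G x ≤ M) (hS : #S ≤ 2)
    (hcl : G.IsClique (B : Set V)) (hb : b + 2 ≤ #B)
    (hT : b * (4 * M + δ * M + M ^ 2) + 2 * M ^ 2 < b * ∑ x, degs G x) :
    δ < #(expand G S B \ B) := by
  by_contra! hδ
  have h := card_mul_sum_degs_le hM hS hcl (by omega)
  have hbB : b ≤ #B - 2 := by omega
  have hmono : 4 * M + #(expand G S B \ B) * M + M ^ 2 ≤ 4 * M + δ * M + M ^ 2 := by gcongr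
  generalize 4 * M + δ * M + M ^ 2 = X at *
  replace h := h.trans (Nat.add_le_add_right (Nat.mul_le_mul_left _ hmono) _)
  -- In the form `b * (Σ - X) ≤ 2 * M ^ 2` the bound is monotone in `b`.
  have hle : (#B - 2) * (∑ x, degs G x - X) ≤ 2 * M ^ 2 := by
    rw [Nat.mul_sub]
    omega
  have hlt : 2 * M ^ 2 < b * (∑ x, degs G x - X) := by
    rw [Nat.mul_sub]
    omega
  exact (hlt.trans_le (Nat.mul_le_mul_right _ hbB)).not_ge hle

theorem sum_add_single_add_single (d : V → ℕ) (i j : V) :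
    ∑ t, (d + Pi.single i 1 + Pi.single j 1 : V → ℕ) t = ∑ t, d t + 2 := by
  simp [sum_add_distrib]

omit [Fintype V] in
theorem add_single_add_single_le (d : V → ℕ) (i j t : V) :
    (d + Pi.single i 1 + Pi.single j 1 : V → ℕ) t ≤ d t + 2 := by
  simp only [Pi.add_apply, Pi.single_apply]
  split_ifs <;> omega

theorem hasRealizationWithin_of_growth {i j : V} {d : V → ℕ} {b δ N k : ℕ}
    (hd : degs G = d + Pi.single i 1 + Pi.single j 1) (hP : Pairable G i j B)
    (hM : ∀ x, d x + 2 ≤ M) (hb : b + 2 ≤ #(layer G {i, j} B k))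
    (hT : b * (4 * M + δ * M + M ^ 2) + 2 * M ^ 2 < b * (∑ x, d x + 2))
    (hN : M + 1 < N * (δ + 1)) : HasRealizationWithin d (4 * (k + N) + 5) G := by
  by_contra hcon
  have hdegs (x : V) : degs G x ≤ M := by
    rw [hd]
    exact (add_single_add_single_le d i j x).trans (hM x)
  rw [← sum_add_single_add_single d i j, ← hd] at hT
  have hcl {l : ℕ} (hl : l ≤ k + N) : G.IsClique (layer G {i, j} B l : Set V) :=
    (isClique_layer_and_isIndepSet_outer hd hP hcon hl).1
  have hgrow (t : ℕ) (ht : t ≤ N) : t * (δ + 1) ≤ #(layer G {i, j} B (k + t)) := by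
    induction t with
    | zero => simp
    | succ t ih =>
      have hsub := layer_mono G {i, j} B (k + t).le_succ
      have hbt : b + 2 ≤ #(layer G {i, j} B (k + t)) :=
        hb.trans (card_le_card (layer_mono _ _ _ (k.le_add_right t)))
      have hδ := lt_card_expand_sdiff (S := {i, j}) hdegs card_le_two (hcl (by omega)) hbt hT
      rw [layer_succ] at hsub
      have hcard := card_sdiff_add_card_eq_card hsub
      rw [← add_assoc, layer_succ, ← hcard, Nat.succ_mul]
      have := ih (by omega)
      omega
  have := hgrow N le_rfl
  have := card_le_of_isClique hdegs (hcl (le_refl (k + N)))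
  omega

end Growth

section Start

variable {V : Type*} [Fintype V] [DecidableEq V] {G : SimpleGraph V} {S : Finset V}
  {i j u v x y : V} {d : V → ℕ} {M b δ N : ℕ}

theorem mem_outer_pair (hxS : x ∉ S) (huv : u ≠ v) (hxu : x ≠ u) (hxv : x ≠ v)
    (hux : ¬ G.Adj u x) (hvx : ¬ G.Adj v x) : x ∈ outer G S {u, v} := by
  refine mem_outer.2 ⟨hxS, (card_pair huv).ge.trans (card_le_card fun y hy => ?_)⟩
  rw [mem_nonNbrs, G.adj_comm]
  grind

theorem exists_large_degree (hM : ∀ x, degs G x ≤ M) (hS : #S ≤ 2) (huv : u ≠ v)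
    (hb : #(expand G S {u, v}) < b + 2) (hT : M ^ 2 + (2 * b + 9) * M < ∑ x, degs G x) :
    ∃ x, x ∉ S ∧ x ≠ u ∧ x ≠ v ∧ ¬ G.Adj u x ∧ b + 2 ≤ degs G x := by
  by_contra! hcon
  let W := nbhd G v \ (nbhd G u ∪ (S ∪ {u, v}))
  have hcover : (univ : Finset V) ⊆ (nbhd G u ∪ (S ∪ {u, v})) ∪ (outer G S {u, v} ∪ W) := by
    intro x _
    by_contra hx
    simp only [W, mem_union, mem_sdiff, mem_nbhd, mem_insert, mem_singleton, not_or] at hx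
    have hout (hxS : x ∉ S) := mem_outer_pair (G := G) hxS huv
    tauto
  have hunion (X Y : Finset V) : ∑ x ∈ X ∪ Y, degs G x ≤ ∑ x ∈ X, degs G x + ∑ x ∈ Y, degs G x :=
    (Nat.le_add_right _ _).trans sum_union_inter.le
  have hsplit : ∑ x, degs G x ≤ (∑ x ∈ nbhd G u, degs G x + ∑ x ∈ S ∪ {u, v}, degs G x) +
      (∑ x ∈ outer G S {u, v}, degs G x + ∑ x ∈ W, degs G x) :=
    (sum_le_sum_of_subset hcover).trans
      ((hunion _ _).trans (add_le_add (hunion _ _) (hunion _ _)))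
  have hu : ∑ x ∈ nbhd G u, degs G x ≤ M * M :=
    (sum_degs_le hM _).trans (Nat.mul_le_mul_right _ (hM u))
  have hfour : ∑ x ∈ S ∪ {u, v}, degs G x ≤ 4 * M :=
    (sum_degs_le hM _).trans (Nat.mul_le_mul_right _
      ((card_union_le _ _).trans (add_le_add hS card_le_two)))
  have houter : ∑ x ∈ outer G S {u, v}, degs G x ≤ (b + 3) * M :=
    (sum_degs_outer_le hM hS).trans (Nat.mul_le_mul_right _ (by omega))
  have hW : ∑ x ∈ W, degs G x ≤ M * (b + 2) := by
    refine (sum_le_card_nsmul _ _ (b + 2) fun x hx => ?_).trans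
      (Nat.mul_le_mul_right _ ((card_le_card sdiff_subset).trans (hM v)))
    simp only [W, mem_union, mem_sdiff, mem_nbhd, mem_insert, mem_singleton, not_or] at hx
    exact (hcon x hx.2.2.1 hx.2.2.2.1 hx.2.2.2.2 hx.2.1).le
  nlinarith

theorem degs_hinge_of_surplus (hd : degs G = d + Pi.single i 1 + Pi.single j 1) (hiu : G.Adj i u)
    (hux : u ≠ x) (h : ¬ G.Adj u x) :
    degs (hinge G i u x) = d + Pi.single x 1 + Pi.single j 1 := by
  refine add_right_cancel (b := Pi.single i 1) ((degs_hinge hiu hux h).trans ?_)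
  rw [hd]
  abel

theorem hasRealizationWithin_of_double_surplus (hd : degs G = d + Pi.single x 1 + Pi.single x 1)
    (hM : ∀ x, d x + 2 ≤ M) (hx : b ≤ d x)
    (hT : b * (4 * M + δ * M + M ^ 2) + 2 * M ^ 2 < b * (∑ x, d x + 2))
    (hN : M + 1 < N * (δ + 1)) : HasRealizationWithin d (4 * N + 5) G := by
  have hP : Pairable G x x (nbhd G x) := by
    refine ⟨by simp, fun c hc c' hc' _ => Or.inl ⟨mem_nbhd.1 hc, mem_nbhd.1 hc'⟩⟩
  have hcard : degs G x = d x + 1 + 1 := by simpa using congrFun hd x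
  exact (hasRealizationWithin_of_growth (k := 0) hd hP hM (hcard.ge.trans' (by omega)) hT
    hN).mono (by omega)

theorem hasRealizationWithin_of_large_degree (hd : degs G = d + Pi.single x 1 + Pi.single y 1)
    (hM : ∀ x, d x + 2 ≤ M) (hx : b ≤ d x) (hy : b + 2 ≤ d y)
    (hT : b * (4 * M + δ * M + M ^ 2) + 2 * M ^ 2 < b * (∑ x, d x + 2))
    (hN : M + 1 < N * (δ + 1)) : HasRealizationWithin d (4 * N + 7) G := by
  rcases eq_or_ne x y with rfl | hxy
  · exact (hasRealizationWithin_of_double_surplus hd hM hx hT hN).mono (by omega)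
  by_cases hex : ∃ c, G.Adj y c ∧ c ≠ x ∧ ¬ G.Adj c x
  · obtain ⟨c, hyc, hcx, hn⟩ := hex
    rw [add_right_comm] at hd
    exact ((hasRealizationWithin_of_double_surplus (degs_hinge_of_surplus hd hyc hcx hn) hM hx hT
      hN).of_close (close_hinge G y c x)).mono (by omega)
  · push Not at hex
    have hP : Pairable G x y ((nbhd G y).erase x) := by
      refine ⟨by simp, fun c hc c' hc' _ => Or.inl ?_⟩
      rw [mem_erase, mem_nbhd] at hc hc'
      exact ⟨(hex c hc.2 hc.1).symm, hc'.2⟩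
    have hcard : degs G y = d y + 1 := by simpa [hxy.symm] using congrFun hd y
    have herase : degs G y - 1 ≤ #((nbhd G y).erase x) := pred_card_le_card_erase
    exact (hasRealizationWithin_of_growth (k := 0) hd hP hM
      (show b + 2 ≤ #((nbhd G y).erase x) by omega) hT hN).mono (by omega)

omit [DecidableEq V] in
theorem exists_pair_of_three_le_degs (hi : 3 ≤ degs G i) (hj : 3 ≤ degs G j) :
    ∃ u v, G.Adj i u ∧ G.Adj j v ∧ u ≠ v ∧ u ≠ j ∧ v ≠ i := by
  classical
  obtain ⟨u, hu, huj⟩ := exists_mem_ne (s := nbhd G i) (Nat.lt_of_succ_lt hi) j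
  obtain ⟨v, hv, hv'⟩ := exists_mem_notMem_of_card_lt_card
    (card_le_two (a := i) (b := u) |>.trans_lt hj)
  rw [mem_insert, mem_singleton, not_or] at hv'
  exact ⟨u, v, mem_nbhd.1 hu, mem_nbhd.1 hv, Ne.symm hv'.2, huj, hv'.1⟩

omit [Fintype V] in
theorem pairable_pair (hiu : G.Adj i u) (hjv : G.Adj j v) (huj : u ≠ j) (hvi : v ≠ i) :
    Pairable G i j {u, v} := by
  have := hiu.ne
  have := hjv.ne
  exact ⟨by simp_all [eq_comm], by grind⟩

theorem hasRealizationWithin_of_surplus (hd : degs G = d + Pi.single i 1 + Pi.single j 1)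
    (hM : ∀ x, d x + 2 ≤ M) (hm : ∀ x, 2 ≤ d x)
    (hT : b * (4 * M + δ * M + M ^ 2) + 2 * M ^ 2 < b * (∑ x, d x + 2))
    (hN : M + 1 < N * (δ + 1)) (hQ : M ^ 2 + (2 * b + 9) * M < ∑ x, d x + 2) :
    HasRealizationWithin d (4 * N + 11) G := by
  have hdi : degs G i = _ := congrFun hd i
  have hdj : degs G j = _ := congrFun hd j
  simp only [Pi.add_apply, Pi.single_eq_same] at hdi hdj
  have hmi := hm i
  have hmj := hm j
  obtain ⟨u, v, hiu, hjv, huv, huj, hvi⟩ :=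
    exists_pair_of_three_le_degs (G := G) (i := i) (j := j) (by omega) (by omega)
  by_cases hb : b + 2 ≤ #(expand G {i, j} {u, v})
  · exact (hasRealizationWithin_of_growth (k := 1) hd (pairable_pair hiu hjv huj hvi) hM hb hT
      hN).mono (by omega)
  have hdegs (t : V) : degs G t ≤ M := by
    rw [hd]
    exact (add_single_add_single_le d i j t).trans (hM t)
  have hdegs_eq {t : V} (ht : t ∉ ({i, j} : Finset V)) : degs G t = d t := by
    rw [mem_insert, mem_singleton, not_or] at ht
    simp [hd, ht.1, ht.2]
  rw [not_le] at hb
  rw [← sum_add_single_add_single d i j, ← hd] at hQ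
  obtain ⟨x, hxS, hxu, hxv, hux, hx⟩ := exists_large_degree hdegs card_le_two huv hb hQ
  obtain ⟨y, hyS, hyv, -, hvy, hy⟩ :=
    exists_large_degree (S := {i, j}) hdegs card_le_two huv.symm (by rwa [pair_comm v u]) hQ
  rw [hdegs_eq hxS] at hx
  rw [hdegs_eq hyS] at hy
  have hd₁ := degs_hinge_of_surplus hd hiu hxu.symm hux
  have hjv₁ : (hinge G i u x).Adj j v := by
    rw [hinge_adj hxu.symm]
    grind
  have hvy₁ : ¬ (hinge G i u x).Adj v y := by
    rw [hinge_adj hxu.symm]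
    grind
  rw [add_right_comm] at hd₁
  have hd₂ := degs_hinge_of_surplus hd₁ hjv₁ hyv.symm hvy₁
  exact ((hasRealizationWithin_of_large_degree hd₂ hM (by omega) (by omega) hT hN).of_close
    ((close_hinge G i u x).trans (close_hinge _ j v y))).mono (by omega)

end Start

section Counting

theorem ncard_setOf_ncard_le (α : Type*) [Finite α] (m : ℕ) :
    {s : Set α | s.ncard ≤ m}.ncard ≤ (Nat.card α + 1) ^ m := by
  induction m with
  | zero =>
    have h : {s : Set α | s.ncard ≤ 0} = {∅} := by
      ext s
      simp [Set.ncard_eq_zero (Set.toFinite s)]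
    rw [h, Set.ncard_singleton, pow_zero]
  | succ m ih =>
    let adjoin (p : Option α × Set α) : Set α := p.1.elim p.2 fun a => insert a p.2
    have hsub : {s : Set α | s.ncard ≤ m + 1} ⊆
        adjoin '' (Set.univ ×ˢ {s : Set α | s.ncard ≤ m}) := by
      intro s hs
      rcases s.eq_empty_or_nonempty with rfl | ⟨a, ha⟩
      · exact ⟨(none, ∅), by simp, rfl⟩
      · refine ⟨(some a, s \ {a}), ⟨trivial, ?_⟩, Set.insert_sdiff_self_of_mem ha⟩
        rw [Set.mem_ofPred_eq] at hs ⊢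
        grind [Set.ncard_sdiff_singleton_add_one ha]
    calc {s : Set α | s.ncard ≤ m + 1}.ncard
        ≤ (Set.univ ×ˢ {s : Set α | s.ncard ≤ m} : Set (Option α × Set α)).ncard :=
          (Set.ncard_le_ncard hsub).trans (Set.ncard_image_le (Set.toFinite _))
      _ = (Nat.card α + 1) * {s : Set α | s.ncard ≤ m}.ncard := by
          rw [Set.ncard_prod, Set.ncard_univ, Finite.card_option]
      _ ≤ (Nat.card α + 1) ^ (m + 1) := by
          rw [pow_succ']
          exact Nat.mul_le_mul_left _ ih

theorem card_sym2_le (V : Type*) [Finite V] : Nat.card (Sym2 V) ≤ Nat.card V ^ 2 := by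
  rw [sq, ← Nat.card_prod]
  exact Nat.card_le_card_of_surjective _ Sym2.mk_surjective

variable {V : Type*} [Finite V]

theorem close_of_finite (G H : SimpleGraph V) : Close (Nat.card V ^ 2) G H :=
  (Set.ncard_le_card _).trans (card_sym2_le V)

theorem ncard_le_of_close {R R' : Set (SimpleGraph V)} {m : ℕ}
    (h : ∀ G ∈ R, ∃ H ∈ R', Close m G H) : R.ncard ≤ (Nat.card V ^ 2 + 1) ^ m * R'.ncard := by
  choose! F hF hc using h
  calc R.ncard
      ≤ (R' ×ˢ {s : Set (Sym2 V) | s.ncard ≤ m}).ncard := by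
        refine Set.ncard_le_ncard_of_injOn (fun G => (F G, (G ∆ F G).edgeSet))
          (fun G hG => ⟨hF G hG, hc G hG⟩) fun G _ G' _ hGG' => ?_
        obtain ⟨hFG, hdiff⟩ := Prod.mk.inj hGG'
        rw [hFG] at hdiff
        exact symmDiff_left_injective _ (SimpleGraph.edgeSet_injective hdiff)
    _ = {s : Set (Sym2 V) | s.ncard ≤ m}.ncard * R'.ncard := by rw [Set.ncard_prod, mul_comm]
    _ ≤ (Nat.card (Sym2 V) + 1) ^ m * R'.ncard := by gcongr; exact ncard_setOf_ncard_le _ m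
    _ ≤ (Nat.card V ^ 2 + 1) ^ m * R'.ncard := by gcongr; exact card_sym2_le V

theorem boundary_le {D : DegreeSequence} {C : ℝ} (hC : 0 ≤ C)
    (h : ∀ i j, ((realizations (perturb D.deg i j)).ncard : ℝ) ≤ C * (realizations D.deg).ncard) :
    D.boundary ≤ (D.len : ℝ) ^ 2 * C := by
  have hcard : (#{ij : Fin D.len × Fin D.len | ij.1 ≤ ij.2} : ℝ) ≤ (D.len : ℝ) ^ 2 := by
    have := card_filter_le (univ : Finset (Fin D.len × Fin D.len)) fun ij => ij.1 ≤ ij.2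
    rw [card_univ, Fintype.card_prod, Fintype.card_fin, ← sq] at this
    exact_mod_cast this
  refine (sum_le_card_nsmul _ _ C fun ij _ =>
    div_le_of_le_mul₀ (Nat.cast_nonneg _) hC (h ij.1 ij.2)).trans ?_
  rw [nsmul_eq_mul]
  exact mul_le_mul_of_nonneg_right hcard hC

theorem pStable_of_hasRealizationWithin {R : Set DegreeSequence} {m : ℕ}
    (h : ∀ D ∈ R, D.Graphic → ∀ i j G, degs G = perturb D.deg i j →
      HasRealizationWithin D.deg m G) : PStable R := by
  refine ⟨.X ^ 2 * (.X ^ 2 + 1) ^ m, fun D hD hg => ?_⟩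
  simp only [Polynomial.eval_mul, Polynomial.eval_pow, Polynomial.eval_X, Polynomial.eval_add,
    Polynomial.eval_one]
  refine boundary_le (by positivity) fun i j => ?_
  have hcount : (realizations (perturb D.deg i j)).ncard ≤
      (Nat.card (Fin D.len) ^ 2 + 1) ^ m * (realizations D.deg).ncard := by
    refine ncard_le_of_close fun G hG => ?_
    obtain ⟨H, hH, hc⟩ := h D hD hg i j G (mem_realizations.1 hG)
    exact ⟨H, mem_realizations.2 hH, hc⟩
  rw [Nat.card_fin] at hcount
  exact_mod_cast hcount

theorem pStable_of_eventually_hasRealizationWithin {R : Set DegreeSequence} {n₀ m : ℕ}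
    (h : ∀ D ∈ R, n₀ ≤ D.len → ∀ i j G, degs G = perturb D.deg i j →
      HasRealizationWithin D.deg m G) : PStable R := by
  refine pStable_of_hasRealizationWithin (m := max m (n₀ ^ 2)) fun D hD hg i j G hG => ?_
  rcases le_total n₀ D.len with hn | hn
  · exact (h D hD hn i j G hG).mono (le_max_left _ _)
  · obtain ⟨H, hH⟩ := hg
    refine ⟨H, mem_realizations.1 hH, (close_of_finite G H).mono (le_max_of_le_right ?_)⟩
    rw [Nat.card_fin]
    exact Nat.pow_le_pow_left hn 2

end Counting

section PStability

theorem exists_forall_quadratic_lt {ε : ℝ} (hε : 0 < ε) (K : ℝ) : ∃ T₀ : ℕ, ∀ c T : ℕ,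
    T₀ ≤ T → (c : ℝ) ^ 2 ≤ (1 - ε) * T → (1 + ε / 8) * (c + 2) ^ 2 + K * (c + 2) < T := by
  set L := 4 * (1 + ε / 8) + K with hL
  set A := 4 * (1 + ε / 8) + 2 * K + 2 * L ^ 2 / (3 * ε) with hA
  obtain ⟨T₀, hT₀⟩ := exists_nat_gt (2 * A / ε)
  refine ⟨T₀, fun c T hT hc => ?_⟩
  have amgm : L * c ≤ 3 * ε / 8 * c ^ 2 + 2 * L ^ 2 / (3 * ε) := by
    have hsq : 3 * ε / 8 * (c : ℝ) ^ 2 + 2 * L ^ 2 / (3 * ε) - L * c =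
        3 * ε / 8 * (c - 4 * L / (3 * ε)) ^ 2 := by
      field_simp
      ring
    have : 0 ≤ 3 * ε / 8 * (c - 4 * L / (3 * ε)) ^ 2 := by positivity
    linarith
  have hAT : A < ε / 2 * T := by
    have hT' : (T₀ : ℝ) ≤ T := by exact_mod_cast hT
    have := hT₀.trans_le hT'
    rw [div_lt_iff₀ hε] at this
    linarith
  calc (1 + ε / 8) * ((c : ℝ) + 2) ^ 2 + K * (c + 2)
      = (1 + ε / 8) * c ^ 2 + L * c + (4 * (1 + ε / 8) + 2 * K) := by rw [hL]; ring
    _ ≤ (1 + ε / 2) * c ^ 2 + A := by rw [hA]; linarith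
    _ < (1 + ε / 2) * ((1 - ε) * T) + ε / 2 * T := add_lt_add_of_le_of_lt (by gcongr) hAT
    _ ≤ T := by nlinarith [mul_nonneg (sq_nonneg ε) (Nat.cast_nonneg (α := ℝ) T)]

theorem exists_growth_parameters {ε : ℝ} (hε : 0 < ε) : ∃ q T₀ : ℕ, ∀ M T : ℕ, 2 ≤ M →
    T₀ ≤ T → ((M : ℝ) - 2) ^ 2 ≤ (1 - ε) * T → ∃ δ : ℕ,
      q * (4 * M + δ * M + M ^ 2) + 2 * M ^ 2 < q * (T + 2) ∧ M + 1 < q * (δ + 1) ∧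
      M ^ 2 + (2 * q + 9) * M < T + 2 := by
  obtain ⟨q, hq⟩ := exists_nat_ge (32 / ε)
  obtain ⟨T₀, hT₀⟩ := exists_forall_quadratic_lt hε (2 * q + 9)
  refine ⟨q, T₀, fun M T hM hT hMT => ⟨⌊ε * M / 16⌋₊, ?_⟩⟩
  have hquad := hT₀ (M - 2) T hT (by rwa [Nat.cast_sub hM])
  rw [Nat.cast_sub hM, Nat.cast_two, sub_add_cancel] at hquad
  have hqε : 32 ≤ q * ε := (div_le_iff₀ hε).1 hq
  have hq₀ : (0 : ℝ) < q := pos_of_mul_pos_left (by linarith) hε.le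
  have hM₂ : (2 : ℝ) ≤ M := by exact_mod_cast hM
  have hδ_le : (⌊ε * M / 16⌋₊ : ℝ) ≤ ε * M / 16 := Nat.floor_le (by positivity)
  have hlt_δ : ε * M / 16 < (⌊ε * M / 16⌋₊ : ℝ) + 1 := Nat.lt_floor_add_one _
  set δ := ⌊ε * M / 16⌋₊
  have hδM : (δ : ℝ) * M ≤ ε / 16 * M ^ 2 := by nlinarith
  have hεM : 0 < ε / 8 * (M : ℝ) ^ 2 := by positivity
  have hqM : 0 ≤ (q : ℝ) * M := by positivity
  refine ⟨?_, ?_, ?_⟩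
  · have htwo : 2 * (M : ℝ) ^ 2 ≤ q * (ε / 16 * M ^ 2) := by nlinarith [sq_nonneg (M : ℝ)]
    have : (q : ℝ) * (4 * M + δ * M + M ^ 2) + 2 * M ^ 2 < q * (T + 2) :=
      calc (q : ℝ) * (4 * M + δ * M + M ^ 2) + 2 * M ^ 2
          ≤ q * (4 * M + δ * M + M ^ 2) + q * (ε / 16 * M ^ 2) := by gcongr
        _ = q * (4 * M + δ * M + M ^ 2 + ε / 16 * M ^ 2) := by ring
        _ < q * (T + 2) := mul_lt_mul_of_pos_left (by linarith) hq₀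
    exact_mod_cast this
  · have : (M : ℝ) + 1 < q * (δ + 1) :=
      calc (M : ℝ) + 1 ≤ q * ε * M / 16 := by nlinarith
        _ = q * (ε * M / 16) := by ring
        _ < q * (δ + 1) := by gcongr
    exact_mod_cast this
  · have : (M : ℝ) ^ 2 + (2 * q + 9) * M < T + 2 := by linarith
    exact_mod_cast this

namespace DegreeSequence

variable (D : DegreeSequence)

theorem deg_le_maxDeg (i : Fin D.len) : D.deg i ≤ D.maxDeg :=
  le_ciSup (Set.finite_range D.deg).bddAbove i

theorem minDeg_le_deg (i : Fin D.len) : D.minDeg ≤ D.deg i :=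
  ciInf_le (Set.finite_range D.deg).bddBelow i

theorem len_mul_minDeg_le : D.len * D.minDeg ≤ D.total := by
  simpa [total] using card_nsmul_le_sum univ D.deg D.minDeg fun i _ => D.minDeg_le_deg i

end DegreeSequence

theorem pStable_of_sq_maxDeg_le {R : Set DegreeSequence} {ε : ℝ} (hε : 0 < ε)
    (hmin : ∀ D ∈ R, 2 ≤ D.minDeg) (hmax : ∀ D ∈ R, (D.maxDeg : ℝ) ^ 2 ≤ (1 - ε) * D.total) :
    PStable R := by
  obtain ⟨q, T₀, hparam⟩ := exists_growth_parameters hε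
  refine pStable_of_eventually_hasRealizationWithin (n₀ := T₀) (m := 4 * q + 11)
    fun D hD hlen i j G hG => ?_
  have hlen_le : D.len ≤ D.total :=
    (Nat.le_mul_of_pos_right _ (zero_lt_two.trans_le (hmin D hD))).trans D.len_mul_minDeg_le
  obtain ⟨δ, hT, hN, hQ⟩ := hparam (D.maxDeg + 2) D.total (Nat.le_add_left _ _)
    (hlen.trans hlen_le) (by simpa using hmax D hD)
  exact hasRealizationWithin_of_surplus hG (fun x => Nat.add_le_add_right (D.deg_le_maxDeg x) 2)
    (fun x => (hmin D hD).trans (D.minDeg_le_deg x)) hT hN hQ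

theorem sq_maxDeg_le_of_mem_regionGSPlus {ε : ℝ} {D : DegreeSequence} (hD : D ∈ regionGSPlus ε) :
    (D.maxDeg : ℝ) ^ 2 ≤ (1 - ε) * D.total := by
  obtain ⟨-, -, hc₁, hsqrt⟩ := hD
  have hc₁' : (3 : ℝ) ≤ D.maxDeg := by exact_mod_cast hc₁
  exact (Real.le_sqrt' (by linarith)).1 hsqrt

theorem pStable_regionGSPlus {ε : ℝ} (hε : 0 < ε) : PStable (regionGSPlus ε) :=
  pStable_of_sq_maxDeg_le hε (fun _ hD => hD.2.1) fun _ hD => sq_maxDeg_le_of_mem_regionGSPlus hD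

end PStability

section Graphicality

variable {V : Type*} [Fintype V] {G : SimpleGraph V} {d : V → ℕ} {i j : V}

theorem exists_adj_not_adj (h : degs G j < degs G i) : ∃ u, G.Adj i u ∧ u ≠ j ∧ ¬ G.Adj u j := by
  classical
  by_contra! hcon
  refine h.not_ge ?_
  have hsub : (nbhd G i).erase j ⊆ (nbhd G j).erase i := by
    intro u hu
    rw [mem_erase, mem_nbhd] at hu ⊢
    exact ⟨hu.2.ne', (hcon u hu.2 hu.1).symm⟩
  by_cases hij : G.Adj i j
  · rw [degs, degs, ← card_erase_add_one (mem_nbhd.2 hij), ← card_erase_add_one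
      (mem_nbhd.2 hij.symm)]
    exact Nat.add_le_add_right (card_le_card hsub) 1
  · rw [erase_eq_of_notMem (by simpa using hij),
      erase_eq_of_notMem (by simpa using fun e => hij e.symm)] at hsub
    exact card_le_card hsub

theorem exists_degs_eq_of_surplus_dominates (G : SimpleGraph V) (hsum : ∑ x, degs G x = ∑ x, d x)
    (hdom : ∀ i j, d i < degs G i → degs G j < d j → d j ≤ d i) :
    ∃ H : SimpleGraph V, degs H = d := by
  classical
  induction hs : ∑ x, (degs G x - d x) using Nat.strong_induction_on generalizing G with
  | _ s ih =>
  by_cases hle : ∀ x, degs G x ≤ d x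
  · exact ⟨G, funext fun x => (sum_eq_sum_iff_of_le fun x _ => hle x).1 hsum x (mem_univ x)⟩
  push Not at hle
  obtain ⟨i, hi⟩ := hle
  obtain ⟨j, hj⟩ : ∃ j, degs G j < d j := by
    by_contra! hcon
    exact hsum.not_gt (sum_lt_sum (fun x _ => hcon x) ⟨i, mem_univ i, hi⟩)
  have hji := hdom i j hi hj
  obtain ⟨u, hiu, huj, hn⟩ := exists_adj_not_adj (G := G) (i := i) (j := j) (by omega)
  have hH := degs_hinge hiu huj hn
  set H := hinge G i u j
  have hHx (x : V) := congrFun hH x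
  simp only [Pi.add_apply, Pi.single_apply] at hHx
  have hne : i ≠ j := by rintro rfl; omega
  refine ih (∑ x, (degs H x - d x)) ?_ H ?_ (fun x y hx hy => ?_) rfl
  · rw [← hs]
    exact sum_lt_sum (fun x _ => by grind) ⟨i, mem_univ i, by grind⟩
  · have := congrArg (fun f : V → ℕ => ∑ x, f x) hH
    simp only [Pi.add_apply, sum_add_distrib, sum_pi_single', mem_univ, if_true] at this
    omega
  · clear ih hs hsum
    exact hdom x y (by grind) (by grind)

section LinearOrder

variable [LinearOrder V]

/-- The edges of `G` form an initial segment of the colexicographic order, up to the choice of the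
neighbours of the last non-isolated vertex: beyond a missing edge `xy` with `x < y` no vertex has
a neighbour. These are the quasi-complete graphs. -/
def IsQuasiComplete (G : SimpleGraph V) : Prop :=
  ∀ ⦃x y a b⦄, x < y → ¬ G.Adj x y → G.Adj a b → a ≤ y

theorem exists_lt_not_adj (h : ∑ x, degs G x < Fintype.card V * (Fintype.card V - 1)) :
    ∃ x y, x < y ∧ ¬ G.Adj x y := by
  by_contra! hcon
  refine h.not_ge (card_nsmul_le_sum univ (degs G) (Fintype.card V - 1) fun x _ => ?_)
  rw [← card_univ, ← card_erase_of_mem (mem_univ x)]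
  refine card_le_card fun y hy => mem_nbhd.2 ?_
  rcases lt_or_gt_of_ne (ne_of_mem_erase hy) with hyx | hxy
  · exact (hcon y x hyx).symm
  · exact hcon x y hxy

theorem IsQuasiComplete.exists_add_edge (hG : IsQuasiComplete G)
    (h : ∑ x, degs G x < Fintype.card V * (Fintype.card V - 1)) :
    ∃ H : SimpleGraph V, IsQuasiComplete H ∧ ∑ x, degs H x = ∑ x, degs G x + 2 := by
  obtain ⟨y, ⟨x, hxy, hn⟩, hmin⟩ := WellFounded.has_min (wellFounded_lt (α := V))
    {y | ∃ x, x < y ∧ ¬ G.Adj x y} (by obtain ⟨x, y, h⟩ := exists_lt_not_adj h; exact ⟨y, x, h⟩)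
  refine ⟨addEdge G x y, fun x' y' a b hlt hn' hab => ?_, ?_⟩
  · rw [addEdge_adj hxy.ne] at hn' hab
    have hyy' : y ≤ y' := not_lt.1 (hmin y' ⟨x', hlt, fun e => hn' (Or.inl e)⟩)
    rcases hab with hab | ⟨rfl, -⟩ | ⟨rfl, -⟩
    · exact hG hlt (fun e => hn' (Or.inl e)) hab
    · exact hxy.le.trans hyy'
    · exact hyy'
  · rw [degs_addEdge hxy.ne hn, sum_add_single_add_single]

theorem exists_isQuasiComplete {e : ℕ} (h : 2 * e ≤ Fintype.card V * (Fintype.card V - 1)) :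
    ∃ G : SimpleGraph V, IsQuasiComplete G ∧ ∑ x, degs G x = 2 * e := by
  induction e with
  | zero => exact ⟨⊥, fun _ _ _ _ _ _ hab => hab.elim, by simp [degs, nbhd]⟩
  | succ e ih =>
    obtain ⟨G, hG, hsum⟩ := ih (by omega)
    obtain ⟨H, hH, hsum'⟩ := hG.exists_add_edge (by omega)
    exact ⟨H, hH, by omega⟩

theorem exists_least_not_adj (h : degs G j + 1 < Fintype.card V) :
    ∃ w, w ≠ j ∧ ¬ G.Adj j w ∧ ∀ v < w, v ≠ j → G.Adj j v := by
  have hne : {w | w ≠ j ∧ ¬ G.Adj j w}.Nonempty := by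
    by_contra! hcon
    have hsub : univ.erase j ⊆ nbhd G j := fun w hw => by
      by_contra hw'
      exact (hcon ▸ Set.notMem_empty w) ⟨ne_of_mem_erase hw, by simpa using hw'⟩
    have := card_le_card hsub
    rw [card_erase_of_mem (mem_univ j), card_univ] at this
    rw [degs] at h
    omega
  obtain ⟨w, ⟨hwj, hn⟩, hmin⟩ := WellFounded.has_min (wellFounded_lt (α := V)) _ hne
  exact ⟨w, hwj, hn, fun v hv hvj => by_contra fun hn' => hmin v ⟨hvj, hn'⟩ hv⟩

theorem IsQuasiComplete.sum_degs_lt {c : ℕ} (hG : IsQuasiComplete G) (hji : j < i)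
    (hi : 0 < degs G i) (hj : degs G j < c) (hc : c < Fintype.card V) :
    ∑ x, degs G x < (c + 1) * c := by
  obtain ⟨w, hwj, hnw, hmin⟩ := exists_least_not_adj (G := G) (j := j) (by omega)
  obtain ⟨a, ha⟩ := card_pos.1 hi
  have hjw : j < w := by
    by_contra! hwj'
    have := hG (lt_of_le_of_ne hwj' hwj) (fun e => hnw e.symm) (mem_nbhd.1 ha)
    exact this.not_gt hji
  set B : Finset V := {x | x ≤ w} with hB
  have hedge {x y : V} (h : G.Adj x y) : x ∈ B := by simpa [hB] using hG hjw hnw h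
  have hBcard : #B ≤ c + 1 := by
    have hsub : (B.erase w).erase j ⊆ nbhd G j := fun x hx => by
      simp only [hB, mem_erase, mem_filter, mem_univ, true_and] at hx
      exact mem_nbhd.2 (hmin x (lt_of_le_of_ne hx.2.2 hx.2.1) hx.1)
    have := card_le_card hsub
    have := pred_card_le_card_erase (s := B.erase w) (a := j)
    have := pred_card_le_card_erase (s := B) (a := w)
    rw [degs] at hj
    omega
  have hdeg (x : V) (hx : x ∈ B) : degs G x ≤ c := by
    have hsub : nbhd G x ⊆ B.erase x := fun y hy =>
      mem_erase.2 ⟨(mem_nbhd.1 hy).ne', hedge (mem_nbhd.1 hy).symm⟩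
    have := card_le_card hsub
    rw [card_erase_of_mem hx] at this
    rw [degs]
    omega
  calc ∑ x, degs G x = ∑ x ∈ B, degs G x := by
        refine (sum_subset (subset_univ B) fun x _ hx => ?_).symm
        exact card_eq_zero.2 (eq_empty_of_forall_notMem fun y hy => hx (hedge (mem_nbhd.1 hy)))
    _ < ∑ _x ∈ B, c := sum_lt_sum hdeg ⟨j, by simpa [hB] using hjw.le, hj⟩
    _ ≤ (c + 1) * c := by
        rw [sum_const, smul_eq_mul]
        exact Nat.mul_le_mul_right c hBcard

theorem exists_degs_eq_of_antitone {c : ℕ} (hd : Antitone d) (hle : ∀ x, d x ≤ c)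
    (hc : c < Fintype.card V) (heven : Even (∑ x, d x)) (hsum : (c + 1) * c ≤ ∑ x, d x) :
    ∃ H : SimpleGraph V, degs H = d := by
  obtain ⟨e, he⟩ := heven.two_dvd
  have hcard : ∑ x, d x ≤ Fintype.card V * (Fintype.card V - 1) :=
    sum_le_card_nsmul univ d _ fun x _ => (hle x).trans (Nat.le_sub_one_of_lt hc)
  obtain ⟨G, hG, hGsum⟩ := exists_isQuasiComplete (he ▸ hcard)
  rw [← he] at hGsum
  refine exists_degs_eq_of_surplus_dominates G hGsum fun i j hi hj => hd (not_lt.1 fun hji => ?_)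
  have := hG.sum_degs_lt hji (Nat.zero_lt_of_lt hi) (hj.trans_le (hle j)) hc
  omega

end LinearOrder

theorem exists_degs_eq {c : ℕ} (hle : ∀ x, d x ≤ c) (hc : c < Fintype.card V)
    (heven : Even (∑ x, d x)) (hsum : (c + 1) * c ≤ ∑ x, d x) :
    ∃ H : SimpleGraph V, degs H = d := by
  let key (x : V) : ℕᵒᵈ ×ₗ Fin (Fintype.card V) :=
    toLex (OrderDual.toDual (d x), Fintype.equivFin V x)
  have hkey : Function.Injective key := fun x y h =>
    (Fintype.equivFin V).injective (Prod.ext_iff.1 (toLex.injective h)).2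
  let _ : LinearOrder V := LinearOrder.lift' key hkey
  have hanti : Antitone d := fun x y (hxy : key x ≤ key y) =>
    OrderDual.toDual_le_toDual.1 (Prod.Lex.monotone_fst _ _ hxy)
  exact exists_degs_eq_of_antitone hanti hle hc heven hsum

namespace DegreeSequence

variable (D : DegreeSequence)

theorem maxDeg_lt_len : D.maxDeg < D.len := by
  have : Nonempty (Fin D.len) := ⟨⟨0, D.len_pos⟩⟩
  obtain ⟨i, hi⟩ := exists_eq_ciSup_of_finite (f := D.deg)
  exact hi.symm.trans_lt (D.deg_lt i)

theorem graphic_of_maxDeg_mul_le (h : (D.maxDeg + 1) * D.maxDeg ≤ D.total) : D.Graphic := by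
  obtain ⟨H, hH⟩ := exists_degs_eq D.deg_le_maxDeg
    (D.maxDeg_lt_len.trans_eq (Fintype.card_fin _).symm) D.even_sum h
  exact ⟨H, mem_realizations.2 hH⟩

end DegreeSequence

theorem fullyGraphic_regionGSPlus {ε : ℝ} (hε : 0 < ε) : FullyGraphic (regionGSPlus ε) := by
  intro D hD
  have hsq := sq_maxDeg_le_of_mem_regionGSPlus hD
  obtain ⟨hlen, hmin, -, -⟩ := hD
  have htotal : 1 ≤ ε ^ 2 * D.total := by
    have hlen_le : D.len * 2 ≤ D.total := (Nat.mul_le_mul_left _ hmin).trans D.len_mul_minDeg_le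
    have hlen_le' : (D.len : ℝ) * 2 ≤ D.total := by exact_mod_cast hlen_le
    rw [div_le_iff₀ (by positivity)] at hlen
    nlinarith [sq_nonneg ε]
  have hlinear : (D.maxDeg : ℝ) ≤ ε * D.total := by
    refine (abs_le_of_sq_le_sq' ?_ (by positivity)).2
    nlinarith [Nat.cast_nonneg (α := ℝ) D.total]
  refine D.graphic_of_maxDeg_mul_le ?_
  have : ((D.maxDeg : ℝ) + 1) * D.maxDeg ≤ D.total := by linarith
  exact_mod_cast this

end Graphicality

section Examples

/-- The degree sequence `(c, …, c)` of length `n`. -/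
def regularSequence (n c : ℕ) (hc : 0 < c) (hcn : c < n) (heven : Even (n * c)) :
    DegreeSequence where
  len := n
  len_pos := hc.trans hcn
  deg _ := c
  deg_pos _ := hc
  deg_lt _ := hcn
  even_sum := by simpa using heven

section

variable {n c : ℕ} {hc : 0 < c} {hcn : c < n} {heven : Even (n * c)}

theorem total_regularSequence : (regularSequence n c hc hcn heven).total = n * c := by
  change ∑ _x : Fin n, c = n * c
  simp

theorem maxDeg_regularSequence : (regularSequence n c hc hcn heven).maxDeg = c :=
  have : Nonempty (Fin (regularSequence n c hc hcn heven).len) := ⟨⟨0, hc.trans hcn⟩⟩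
  ciSup_const

theorem minDeg_regularSequence : (regularSequence n c hc hcn heven).minDeg = c :=
  have : Nonempty (Fin (regularSequence n c hc hcn heven).len) := ⟨⟨0, hc.trans hcn⟩⟩
  ciInf_const

theorem sqrt_mul_total_regularSequence_iff {r : ℝ} :
    ((regularSequence n c hc hcn heven).maxDeg : ℝ) ≤
      √(r * (regularSequence n c hc hcn heven).total) ↔ (c : ℝ) ≤ r * n := by
  have hc' : (0 : ℝ) < c := by exact_mod_cast hc
  rw [maxDeg_regularSequence, total_regularSequence, Real.le_sqrt' hc', Nat.cast_mul, sq,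
    ← mul_assoc, mul_le_mul_iff_left₀ hc']

theorem regularSequence_mem_regionGSPlus {ε : ℝ} (hc₃ : 3 ≤ c) (hn : 1 / (2 * ε ^ 2) ≤ n)
    (hle : (c : ℝ) ≤ (1 - ε) * n) : regularSequence n c hc hcn heven ∈ regionGSPlus ε :=
  ⟨hn, by rw [minDeg_regularSequence]; omega, by rwa [maxDeg_regularSequence],
    sqrt_mul_total_regularSequence_iff.2 hle⟩

end

theorem infinite_regionGSPlus {ε : ℝ} (hε : ε < 1) : (regionGSPlus ε).Infinite := by
  have hε' : 0 < 1 - ε := sub_pos.2 hε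
  obtain ⟨k, hk⟩ := exists_nat_ge (max (1 / (2 * ε ^ 2)) (3 / (1 - ε)))
  rw [max_le_iff, div_le_iff₀ hε'] at hk
  refine Set.infinite_of_injective_forall_mem (f := fun m : ℕ =>
    regularSequence (2 * (k + m + 2)) 3 three_pos (by omega) (by simp [mul_assoc])) ?_ fun m => ?_
  · intro m m' h
    have : 2 * (k + m + 2) = 2 * (k + m' + 2) := congrArg DegreeSequence.len h
    omega
  · have hkm : (k : ℝ) ≤ ((2 * (k + m + 2) : ℕ) : ℝ) := by exact_mod_cast by omega
    refine regularSequence_mem_regionGSPlus le_rfl (hk.1.trans hkm) ?_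
    push_cast at hkm ⊢
    nlinarith

theorem regionGS_eq_regionGSPlus : regionGS = regionGSPlus (8 / 9) := by
  ext D
  have hlen : (1 : ℝ) ≤ D.len := by exact_mod_cast D.len_pos
  have hmul : (1 - 8 / 9 : ℝ) * D.total = D.total / 9 := by ring
  have hbound : 1 / (2 * (8 / 9) ^ 2) ≤ (D.len : ℝ) := by norm_num; linarith
  simp only [regionGS, regionGSPlus, simpleRegion, Set.mem_ofPred_eq, hmul, hbound, true_and]

theorem regionGS_inter_subset_regionGSPlus {ε : ℝ} (hε : ε ≤ 8 / 9) :
    {D ∈ regionGS | 1 / (2 * ε ^ 2) ≤ (D.len : ℝ)} ⊆ regionGSPlus ε := by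
  rintro D ⟨⟨hmin, hmax, hsqrt⟩, hlen⟩
  refine ⟨hlen, hmin, hmax, hsqrt.trans (Real.sqrt_le_sqrt ?_)⟩
  nlinarith [Nat.cast_nonneg (α := ℝ) D.total]

theorem exists_mem_regionGSPlus_notMem_regionGS {ε : ℝ} (hε : ε < 8 / 9) :
    ∃ D ∈ regionGSPlus ε, D ∉ regionGS := by
  have hε' : 0 < 8 - 9 * ε := by linarith
  obtain ⟨k, hk⟩ := exists_nat_ge (max (1 / (2 * ε ^ 2)) (max 2 (1 / (8 - 9 * ε))))
  rw [max_le_iff, max_le_iff, div_le_iff₀ hε'] at hk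
  obtain ⟨hlen, hk₂, hslope⟩ := hk
  replace hk₂ : 2 ≤ k := by exact_mod_cast hk₂
  -- `c₁ = n / 9 + 1` just misses `c₁² ≤ Σ / 9`, that is, `c₁ ≤ n / 9`
  refine ⟨regularSequence (9 * k) (k + 1) k.succ_pos (by omega)
    (by rw [mul_assoc]; exact (Nat.even_mul_succ_self k).mul_left 9),
    regularSequence_mem_regionGSPlus (by omega) (hlen.trans ?_) ?_, fun h => ?_⟩
  · exact_mod_cast (by omega : k ≤ 9 * k)
  · push_cast
    linarith
  · have := h.2.2
    rw [div_eq_inv_mul, sqrt_mul_total_regularSequence_iff] at this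
    push_cast at this
    linarith

theorem ssubset_regionGSPlus {ε : ℝ} (hε : ε < 8 / 9) :
    {D ∈ regionGS | 1 / (2 * ε ^ 2) ≤ (D.len : ℝ)} ⊂ regionGSPlus ε := by
  obtain ⟨D, hD, hD'⟩ := exists_mem_regionGSPlus_notMem_regionGS hε
  exact (Set.ssubset_iff_of_subset (regionGS_inter_subset_regionGSPlus hε.le)).2
    ⟨D, hD, fun h => hD' h.1⟩

end Examples

theorem theorem2p22 :
    (∀ ε : ℝ, 0 < ε → FullyGraphic (regionGSPlus ε) ∧ PStable (regionGSPlus ε)) ∧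
    (∀ ε : ℝ, 0 < ε → ε < 1 → (regionGSPlus ε).Infinite) ∧
    regionGS = regionGSPlus (8 / 9) ∧
    (∀ ε : ℝ, 0 < ε → ε < 8 / 9 →
      {D ∈ regionGS | 1 / (2 * ε ^ 2) ≤ (D.len : ℝ)} ⊂ regionGSPlus ε) :=
  ⟨fun _ hε => ⟨fullyGraphic_regionGSPlus hε, pStable_regionGSPlus hε⟩,
    fun _ _ hε₁ => infinite_regionGSPlus hε₁, regionGS_eq_regionGSPlus,
    fun _ _ hε₁ => ssubset_regionGSPlus hε₁⟩
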